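/- Let $\psi=\Gamma'/\Gamma$ be the digamma function, $\zeta$ the Riemann zeta function, $H_m=\sum_{i=1}^m \frac1i$, and let $G=\sum_{k\ge 0}\frac{(-1)^k}{(2k+1)^2}$ be Catalan's constant. For integers $n\ge 0$ put $$\Theta_1(n,1)=\sum_{k=1}^\infty \frac{\psi\left(\frac{2k+2n+5}{4}\right)-\psi\left(\frac{2k+2n+3}{4}\right)}{(2k+1)^2}.$$ All the infinite series below converge absolutely, and the following hold. (a) $\displaystyle\sum_{k=1}^\infty \frac{(-1)^k}{(2k+1)^2}\sum_{j=1}^k\frac{(-1)^{j-1}}{2j+1}=G-\frac{\pi^2}{16}\ln 2-\frac{7}{16}\zeta(3).$ (b) $\displaystyle\Theta_1(0,1)=-4+(1-G)\pi+\frac{\pi^2}{4}\ln 2+\frac74\zeta(3).$ (c) $\displaystyle\Theta_1(1,1)=\frac53-(1-G)\pi+(1-\ln 2)\frac{\pi^2}{4}-\frac74\zeta(3).$ (d) $\displaystyle\Theta_1(2,1)=-\frac{14}{5}+(1-G)\pi+\left(\ln 2-\frac12\right)\frac{\pi^2}{4}+\frac74\zeta(3).$ (e) If $n$ is odd and $n\ne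 1$, then $$\begin{aligned}\Theta_1(n,1)={}&3-\frac18\sum_{j=1}^{\frac{n-1}{2}}\frac{(4j+1)(H_{2j-1}-2H_{4j-1})}{j^2(2j+1)^2}-\sum_{j=1}^{\frac{n-1}{2}}\frac{1}{(2j+1)^2(4j+1)}+4\sum_{j=1}^n\frac{(-1)^j}{2j+1}\\&-(1-G)\pi+\left(1-\ln 2-\frac12\sum_{j=1}^{\frac{n-1}{2}}\frac{1}{j(2j+1)}\right)\frac{\pi^2}{4}-\frac74\zeta(3).\end{aligned}$$ (f) If $n$ is even and $n\ge 4$, then $$\begin{aligned}\Theta_1(n,1)={}&-\frac{10}{3}-\frac18\sum_{j=1}^{\frac{n-2}{2}}\frac{(4j+3)(H_{2j-1}-2H_{4j-1})}{(j+1)^2(2j+1)^2}-\sum_{j=1}^{\frac{n-2}{2}}\frac{4j^3+j^2-4j-2}{(j+1)^2(2j+1)^2(4j+3)(4j+1)}\\&-4\sum_{j=1}^n\frac{(-1)^j}{2j+1}+(1-G)\pi+\left(\ln 2-\frac12-\frac12\sum_{j=1}^{\frac{n-2}{2}}\frac{1}{(j+1)(2j+1)}\right)\frac{\pi^2}{4}+\frac74\zeta(3).\end{aligned}$$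 -/

import Mathlib

/-- Catalan's constant `G = ∑_{k ≥ 0} (-1)^k / (2k+1)^2` (an absolutely convergent series). -/
noncomputable def catalanConst : ℝ := ∑' k : ℕ, (-1 : ℝ) ^ k / (2 * (k : ℝ) + 1) ^ 2

/-- The `k`-th term of the series `Θ₁(n, 1)`, where `ψ` is the digamma function. -/
noncomputable def thetaTerm (n k : ℕ) : ℂ :=
  (Complex.digamma ((2 * (k : ℂ) + 2 * (n : ℂ) + 5) / 4) -
    Complex.digamma ((2 * (k : ℂ) + 2 * (n : ℂ) + 3) / 4)) / (2 * (k : ℂ) + 1) ^ 2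

/-!
Write `β m = ψ((2m+5)/4) - ψ((2m+3)/4)`, so that the `k`-th term of `Θ₁(n, 1)` is
`β (k+n) / (2k+1)²`. The functional equation of `ψ` gives `β m + β (m+1) = 4 / (2m+3)`
(`digamma_half_shift_add`), and the reflection formula at `1/4` gives `β 0 = 4 - π`. Hence `β m` is
an explicit finite sum (`digamma_half_shift_eq`), and `Θ₁(0, 1)` reduces to Catalan's constant and
the double series of part (a). Adding the terms of `Θ₁(n, 1)` and `Θ₁(n+1, 1)` leaves
`4 / ((2k+2n+3)(2k+1)²)`, which partial fractions and telescoping sum in closed form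
(`hasSum_thetaTerm_succ`); two such steps carry the odd and the even formula from `n` to `n + 2`,
once the partial sums of `∑ 1/(2i+3)` are written through harmonic numbers.

The analytic heart is the double series, `∑ (-1)^k / (2k+1)² · A k` with
`A k = ∑_{j ≤ k} (-1)^j / (2j+1)`. By the Dirichlet kernel,
`∫_0^{π/2} sin((2k+1)v) cot v dv = 2 A k - (-1)^k / (2k+1)` (`integral_sin_odd_mul_cot`). On the other
hand `∑ (-1)^k sin((2k+1)v) / (2k+1)² = π v / 4` on `[0, π/2]`, by the Fourier series of the second
Bernoulli polynomial. Integrating this against `cot v` term by term, which is legitimate since the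
terms are at most `(2k+1)^(-3/2) v^(-1/2)`, leaves `π/4 · ∫_0^{π/2} v cot v dv = π²/8 · log 2`, and
the correction terms `1 / (2k+1)³` contribute the multiple of `ζ(3)`.
-/

/-! ### Trigonometric integrals on `[0, π/2]` -/

open MeasureTheory Set Filter Topology in
/-- Integration by parts against `log (sin v)`, whose integral is known. -/
theorem integral_mul_cot : ∫ v in (0 : ℝ)..(Real.pi / 2), v * (Real.cos v / Real.sin v) =
    Real.pi / 2 * Real.log 2 := by
  have hpi : (0 : ℝ) < Real.pi / 2 := by positivity
  have hsinc : ∀ v ∈ Icc (0 : ℝ) (Real.pi / 2), Real.sinc v ≠ 0 := by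
    intro v hv
    rcases eq_or_lt_of_le hv.1 with h | h
    · simp [← h]
    · rw [Real.sinc_of_ne_zero h.ne']
      exact (div_pos (Real.sin_pos_of_pos_of_lt_pi h (by linarith [hv.2])) h).ne'
  -- At `0` the junk value `log 0 = 0` agrees with the limit of `v * log (sin v)`; continuity is
  -- seen by writing `sin v = v * sinc v`.
  have hcont : ContinuousOn (fun v : ℝ => v * Real.log (Real.sin v)) (Icc 0 (Real.pi / 2)) := by
    have h1 : ContinuousOn (fun v : ℝ => v * Real.log v + v * Real.log (Real.sinc v))
        (Icc 0 (Real.pi / 2)) :=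
      Real.continuous_mul_log.continuousOn.add
        (continuousOn_id.mul (Real.continuous_sinc.continuousOn.log hsinc))
    refine h1.congr fun v hv => ?_
    rcases eq_or_lt_of_le hv.1 with h | h
    · simp [← h]
    · have hs := hsinc v hv
      simp only
      rw [← mul_add, ← Real.log_mul h.ne' hs, Real.sinc_of_ne_zero h.ne', mul_div_cancel₀ _ h.ne']
  have hint : IntervalIntegrable (fun v : ℝ => v * (Real.cos v / Real.sin v)) volume 0
      (Real.pi / 2) := by
    have h1 : IntervalIntegrable (fun v : ℝ => Real.cos v / Real.sinc v) volume 0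
        (Real.pi / 2) := by
      apply ContinuousOn.intervalIntegrable
      rw [uIcc_of_le hpi.le]
      exact Real.continuous_cos.continuousOn.div Real.continuous_sinc.continuousOn hsinc
    refine h1.congr fun v hv => ?_
    rw [uIoc_of_le hpi.le] at hv
    rw [Real.sinc_of_ne_zero hv.1.ne']
    field_simp
  have hlog : IntervalIntegrable (fun v : ℝ => Real.log (Real.sin v)) volume 0 (Real.pi / 2) :=
    intervalIntegrable_log_sin
  have key := intervalIntegral.integral_eq_sub_of_hasDerivAt_of_le hpi.le hcont
    (f' := fun v => Real.log (Real.sin v) + v * (Real.cos v / Real.sin v)) (fun v hv => by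
      have hs : Real.sin v ≠ 0 := (Real.sin_pos_of_pos_of_lt_pi hv.1 (by linarith [hv.2])).ne'
      convert! (hasDerivAt_id v).mul ((Real.hasDerivAt_sin v).log hs) using 1
      simp) (hlog.add hint)
  rw [intervalIntegral.integral_add hlog hint, integral_log_sin_zero_pi_div_two] at key
  simp at key
  linarith

theorem sin_odd_mul_pi_div_two (k : ℕ) :
    Real.sin ((2 * (k : ℝ) + 1) * (Real.pi / 2)) = (-1) ^ k := by
  have : (2 * (k : ℝ) + 1) * (Real.pi / 2) = Real.pi / 2 + k * Real.pi := by ring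
  rw [this, Real.sin_add_nat_mul_pi]; simp

theorem cos_odd_mul_pi_div_two (k : ℕ) :
    Real.cos ((2 * (k : ℝ) + 1) * (Real.pi / 2)) = 0 := by
  have : (2 * (k : ℝ) + 1) * (Real.pi / 2) = Real.pi / 2 + k * Real.pi := by ring
  rw [this, Real.cos_add_nat_mul_pi]; simp

/-- A Dirichlet-kernel identity: both sides equal `sin ((2k+2)v)`. -/
theorem two_mul_sum_cos_odd_mul_sin (k : ℕ) (v : ℝ) :
    2 * (∑ j ∈ Finset.range (k + 1), Real.cos ((2 * (j : ℝ) + 1) * v)) * Real.sin v =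
      Real.sin ((2 * (k : ℝ) + 1) * v) * Real.cos v +
        Real.cos ((2 * (k : ℝ) + 1) * v) * Real.sin v := by
  induction k with
  | zero => simp; ring
  | succ k ih =>
    rw [Finset.sum_range_succ, mul_add, add_mul, ih]
    push_cast
    have e : (2 * ((k : ℝ) + 1) + 1) * v = (2 * (k : ℝ) + 1) * v + 2 * v := by ring
    rw [e, Real.sin_add, Real.cos_add, Real.sin_two_mul, Real.cos_two_mul]
    have := Real.sin_sq_add_cos_sq v
    have hs : Real.cos v ^ 2 = 1 - Real.sin v ^ 2 := by linarith
    ring_nf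
    have h3 : Real.cos v ^ 3 = Real.cos v * (1 - Real.sin v ^ 2) := by rw [← hs]; ring
    rw [h3, hs]
    ring

open MeasureTheory Set in
theorem integral_sin_odd_mul_cot (k : ℕ) :
    ∫ v in (0 : ℝ)..(Real.pi / 2), Real.sin ((2 * (k : ℝ) + 1) * v) * (Real.cos v / Real.sin v) =
      2 * (∑ j ∈ Finset.range (k + 1), (-1 : ℝ) ^ j / (2 * (j : ℝ) + 1)) -
        (-1) ^ k / (2 * (k : ℝ) + 1) := by
  have hpi : (0 : ℝ) < Real.pi / 2 := by positivity
  have hcos : ∀ j : ℕ, ∫ v in (0 : ℝ)..(Real.pi / 2), Real.cos ((2 * (j : ℝ) + 1) * v) =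
      (-1 : ℝ) ^ j / (2 * (j : ℝ) + 1) := by
    intro j
    have h : (2 * (j : ℝ) + 1) ≠ 0 := by positivity
    rw [intervalIntegral.integral_comp_mul_left (fun x => Real.cos x) h, integral_cos,
      sin_odd_mul_pi_div_two]
    simp; ring
  have hci : ∀ j : ℕ, IntervalIntegrable (fun v => Real.cos ((2 * (j : ℝ) + 1) * v)) volume 0
      (Real.pi / 2) := fun j => Continuous.intervalIntegrable (by fun_prop) _ _
  have hcongr : ∫ v in (0 : ℝ)..(Real.pi / 2),
      Real.sin ((2 * (k : ℝ) + 1) * v) * (Real.cos v / Real.sin v) =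
      ∫ v in (0 : ℝ)..(Real.pi / 2),
        (2 * (∑ j ∈ Finset.range (k + 1), Real.cos ((2 * (j : ℝ) + 1) * v)) -
          Real.cos ((2 * (k : ℝ) + 1) * v)) := by
    rw [intervalIntegral.integral_of_le hpi.le, intervalIntegral.integral_of_le hpi.le]
    refine setIntegral_congr_fun measurableSet_Ioc fun v hv => ?_
    have hs : Real.sin v ≠ 0 := (Real.sin_pos_of_pos_of_lt_pi hv.1 (by linarith [hv.2])).ne'
    have := two_mul_sum_cos_odd_mul_sin k v
    rw [← mul_div_assoc, div_eq_iff hs]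
    linarith
  rw [hcongr, intervalIntegral.integral_sub _ (hci k), intervalIntegral.integral_const_mul,
    intervalIntegral.integral_finsetSum (fun j _ => hci j)]
  · simp only [hcos]
  · exact Continuous.intervalIntegrable (by fun_prop) _ _

/-! ### Series over the odd integers -/

/-- The odd-indexed part of a convergent series over `ℕ`, from the full series and its
even-indexed part. -/
theorem HasSum.odd_of_even {f : ℕ → ℝ} {a b : ℝ} (hf : HasSum f a)
    (he : HasSum (fun k => f (2 * k)) b) : HasSum (fun k => f (2 * k + 1)) (a - b) := by
  have ho : Summable fun k => f (2 * k + 1) :=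
    hf.summable.comp_injective (i := fun k => 2 * k + 1) fun x y h => by simpa using h
  have := (he.even_add_odd ho.hasSum).unique hf
  rw [← this, add_sub_cancel_left]
  exact ho.hasSum

/-- The Fourier series of a triangle wave, as the odd-indexed part of the Fourier series of the
second Bernoulli polynomial. -/
theorem hasSum_sin_odd_div_sq {v : ℝ} (h0 : 0 ≤ v) (h1 : v ≤ Real.pi / 2) :
    HasSum (fun k : ℕ => (-1 : ℝ) ^ k / (2 * (k : ℝ) + 1) ^ 2 * Real.sin ((2 * (k : ℝ) + 1) * v))
      (Real.pi * v / 4) := by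
  have hpi := Real.pi_pos
  have hcos : ∀ x : ℝ, x ∈ Set.Icc (0 : ℝ) 1 →
      HasSum (fun n : ℕ => 1 / (n : ℝ) ^ 2 * Real.cos (2 * Real.pi * n * x))
        (Real.pi ^ 2 * (x ^ 2 - x + 6⁻¹)) := by
    intro x hx
    have := hasSum_one_div_nat_pow_mul_cos one_ne_zero hx
    have e : (Polynomial.map (algebraMap ℚ ℝ) (Polynomial.bernoulli (2 * 1))).eval x =
      x ^ 2 - x + 6⁻¹ := bernoulliFun_two x
    rw [e] at this
    convert! this using 1
    simp only [Nat.factorial]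
    push_cast
    ring
  -- The angle `2πx` is the complement `π/2 - v`, which turns cosines at odd multiples into sines.
  set x : ℝ := 1 / 4 - v / (2 * Real.pi) with hx
  have hvx : v / (2 * Real.pi) ≤ 1 / 4 := by
    rw [div_le_iff₀ (by positivity)]; linarith
  have hv0 : 0 ≤ v / (2 * Real.pi) := by positivity
  have hfull := hcos x ⟨by linarith, by linarith⟩
  have heven := (hcos (2 * x) ⟨by linarith, by linarith⟩).mul_left (1 / 4)
  have hodd := hfull.odd_of_even (by
    refine heven.congr_fun ?_
    intro k
    push_cast
    rw [show 2 * Real.pi * (2 * (k : ℝ)) * x = 2 * Real.pi * k * (2 * x) by ring]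
    ring)
  convert! hodd using 1
  · ext k
    have e : 2 * Real.pi * ((2 * k + 1 : ℕ) : ℝ) * x =
        (2 * (k : ℝ) + 1) * (Real.pi / 2) - (2 * (k : ℝ) + 1) * v := by
      rw [hx]; push_cast; field_simp; ring
    rw [e, Real.cos_sub, sin_odd_mul_pi_div_two, cos_odd_mul_pi_div_two]
    push_cast
    ring
  · rw [hx]; field_simp; ring

theorem hasSum_one_div_odd_sq : HasSum (fun k : ℕ => 1 / (2 * (k : ℝ) + 1) ^ 2)
    (Real.pi ^ 2 / 8) := by
  have h := hasSum_sin_odd_div_sq (v := Real.pi / 2) (by positivity) le_rfl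
  convert! h using 1
  · ext k
    rw [sin_odd_mul_pi_div_two, div_mul_eq_mul_div, ← mul_pow]; simp
  · ring

theorem hasSum_one_div_odd_cube : HasSum (fun k : ℕ => 1 / (2 * (k : ℝ) + 1) ^ 3)
    (7 / 8 * ∑' n : ℕ, 1 / (n : ℝ) ^ 3) := by
  have h : Summable fun n : ℕ => 1 / (n : ℝ) ^ 3 := Real.summable_one_div_nat_pow.2 (by norm_num)
  have := h.hasSum.odd_of_even (b := 1 / 8 * ∑' n : ℕ, 1 / (n : ℝ) ^ 3) (by
    refine (h.hasSum.mul_left (1 / 8)).congr_fun ?_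
    intro k
    push_cast
    ring)
  convert! this using 1
  · ext k; push_cast; ring
  · ring

theorem summable_neg_one_pow_div_odd_sq :
    Summable fun k : ℕ => (-1 : ℝ) ^ k / (2 * (k : ℝ) + 1) ^ 2 := by
  refine Summable.of_norm ?_
  convert hasSum_one_div_odd_sq.summable using 2 with k
  rw [norm_div, norm_pow, norm_neg, norm_one, one_pow, Real.norm_of_nonneg (by positivity)]

/-! ### The alternating double series -/

/-- Interpolates between the bounds `1` and `x`; the exponent `1/2` keeps both the sum over `k` and
the integral over `v` in `hasSum_integral_sin_odd_mul_cot` convergent. -/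
theorem abs_sin_le_sqrt {x : ℝ} (hx : 0 ≤ x) : |Real.sin x| ≤ √x := by
  apply Real.abs_le_sqrt
  have h1 : |Real.sin x| ≤ 1 := Real.abs_sin_le_one x
  have h2 : |Real.sin x| ≤ x := by simpa [abs_of_nonneg hx] using Real.abs_sin_le_abs (x := x)
  rw [← sq_abs, sq]
  nlinarith [abs_nonneg (Real.sin x)]

open MeasureTheory Set in
theorem hasSum_integral_sin_odd_mul_cot :
    HasSum (fun k : ℕ => (-1 : ℝ) ^ k / (2 * (k : ℝ) + 1) ^ 2 *
      ∫ v in (0 : ℝ)..(Real.pi / 2), Real.sin ((2 * (k : ℝ) + 1) * v) * (Real.cos v / Real.sin v))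
      (Real.pi ^ 2 / 8 * Real.log 2) := by
  have hpi : (0 : ℝ) < Real.pi / 2 := by positivity
  have hsum : Summable fun k : ℕ => (2 * (k : ℝ) + 1) ^ (-(3 / 2) : ℝ) := by
    have := (Real.summable_nat_rpow (p := -(3 / 2))).2 (by norm_num)
    have := this.comp_injective (i := fun k : ℕ => 2 * k + 1) fun x y h => by simpa using h
    refine this.congr fun k => ?_
    simp
  have key := intervalIntegral.hasSum_integral_of_dominated_convergence (μ := volume) (a := 0)
    (b := Real.pi / 2)
    (F := fun (k : ℕ) v => (-1 : ℝ) ^ k / (2 * (k : ℝ) + 1) ^ 2 *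
      (Real.sin ((2 * (k : ℝ) + 1) * v) * (Real.cos v / Real.sin v)))
    (f := fun v => Real.pi / 4 * (v * (Real.cos v / Real.sin v)))
    (fun k v => (2 * (k : ℝ) + 1) ^ (-(3 / 2) : ℝ) * v ^ (-(1 / 2) : ℝ))
    (fun k => Measurable.aestronglyMeasurable (by fun_prop)) ?_ ?_ ?_ ?_
  · simp only [intervalIntegral.integral_const_mul] at key
    rw [integral_mul_cot] at key
    convert! key using 1
    ring
  · refine fun k => Filter.Eventually.of_forall fun v hv => ?_
    rw [uIoc_of_le hpi.le] at hv
    have hk : (0 : ℝ) < 2 * (k : ℝ) + 1 := by positivity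
    have hsv : 0 < Real.sin v := Real.sin_pos_of_pos_of_lt_pi hv.1 (by linarith [hv.2])
    have hcv : 0 ≤ Real.cos v := Real.cos_nonneg_of_mem_Icc ⟨by linarith [hv.1], hv.2⟩
    have hcot : Real.cos v / Real.sin v ≤ 1 / v := by
      rcases eq_or_lt_of_le hv.2 with h | h
      · rw [h]; simp; positivity
      · have hc : 0 < Real.cos v := Real.cos_pos_of_mem_Ioo ⟨by linarith [hv.1], h⟩
        have := Real.lt_tan hv.1 h
        rw [Real.tan_eq_sin_div_cos, lt_div_iff₀ hc] at this
        rw [div_le_div_iff₀ hsv hv.1]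
        linarith
    rw [norm_mul, norm_mul, norm_div, norm_pow, norm_neg, norm_one, one_pow,
      Real.norm_of_nonneg (by positivity : 0 ≤ (2 * (k : ℝ) + 1) ^ 2),
      Real.norm_of_nonneg (div_nonneg hcv hsv.le)]
    have hsin := abs_sin_le_sqrt (mul_pos hk hv.1).le
    calc _ ≤ 1 / (2 * (k : ℝ) + 1) ^ 2 * (√((2 * (k : ℝ) + 1) * v) * (1 / v)) := by
          rw [Real.norm_eq_abs]
          gcongr
      _ = _ := by
          have e1 : (2 * (k : ℝ) + 1) ^ (-(3 / 2) : ℝ) =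
              √(2 * (k : ℝ) + 1) / (2 * (k : ℝ) + 1) ^ 2 := by
            rw [Real.sqrt_eq_rpow, ← Real.rpow_natCast, ← Real.rpow_sub hk]; norm_num
          have e2 : v ^ (-(1 / 2) : ℝ) = √v / v := by
            conv_rhs => rw [Real.sqrt_eq_rpow]
            nth_rewrite 3 [← Real.rpow_one v]
            rw [← Real.rpow_sub hv.1]; norm_num
          rw [e1, e2, Real.sqrt_mul hk.le]
          ring
  · exact Filter.Eventually.of_forall fun v _ => hsum.mul_right _
  · simp only [tsum_mul_right]
    exact (intervalIntegral.intervalIntegrable_rpow' (by norm_num)).const_mul _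
  · refine Filter.Eventually.of_forall fun v hv => ?_
    rw [uIoc_of_le hpi.le] at hv
    have := (hasSum_sin_odd_div_sq hv.1.le hv.2).mul_right (Real.cos v / Real.sin v)
    simp only [← mul_assoc]
    convert! this using 1
    ring

theorem hasSum_alternating_euler_sum :
    HasSum (fun k : ℕ => (-1 : ℝ) ^ k / (2 * (k : ℝ) + 1) ^ 2 *
        ∑ j ∈ Finset.range (k + 1), (-1 : ℝ) ^ j / (2 * (j : ℝ) + 1))
      (Real.pi ^ 2 / 16 * Real.log 2 + 7 / 16 * ∑' n : ℕ, 1 / (n : ℝ) ^ 3) := by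
  have h := (hasSum_integral_sin_odd_mul_cot.add hasSum_one_div_odd_cube).mul_left (1 / 2)
  convert! h using 1
  · ext k
    have h1 : ((-1 : ℝ) ^ k) ^ 2 = 1 := by rw [← pow_mul, mul_comm, pow_mul]; simp
    rw [integral_sin_odd_mul_cot]
    field_simp
    linear_combination h1
  · ring

/-- The inner sums here start at `j = 1` with the opposite sign, so they are `1` minus those in
`hasSum_alternating_euler_sum`; the `1` produces Catalan's constant. -/
theorem hasSum_alternating_euler_sum_tail :
    HasSum (fun k : ℕ => (-1 : ℝ) ^ k / (2 * (k : ℝ) + 1) ^ 2 *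
        ∑ j ∈ Finset.Icc 1 k, (-1 : ℝ) ^ (j - 1) / (2 * (j : ℝ) + 1))
      (catalanConst - Real.pi ^ 2 / 16 * Real.log 2 - 7 / 16 * ∑' n : ℕ, 1 / (n : ℝ) ^ 3) := by
  have h := summable_neg_one_pow_div_odd_sq.hasSum.sub hasSum_alternating_euler_sum
  convert! h using 1
  · ext k
    have hS : ∑ j ∈ Finset.Icc 1 k, (-1 : ℝ) ^ (j - 1) / (2 * (j : ℝ) + 1) =
        1 - ∑ j ∈ Finset.range (k + 1), (-1 : ℝ) ^ j / (2 * (j : ℝ) + 1) := by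
      induction k with
      | zero => simp
      | succ k ih =>
        rw [Finset.sum_Icc_succ_top (by lia), ih, Finset.sum_range_succ _ (k + 1),
          Nat.add_sub_cancel, pow_succ (-1 : ℝ) k]
        ring
    rw [hS]
    ring
  · rw [catalanConst]; ring

/-! ### A telescoping series -/

open Filter Topology in
theorem hasSum_sub_shift_of_antitone {a : ℕ → ℝ} (ha : Antitone a)
    (h0 : Tendsto a atTop (𝓝 0)) (N : ℕ) :
    HasSum (fun k => a k - a (k + N)) (∑ i ∈ Finset.range N, a i) := by
  induction N with
  | zero => simp
  | succ N ih =>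
    have hstep : HasSum (fun k => a (k + N) - a (k + 1 + N)) (a N) := by
      rw [hasSum_iff_tendsto_nat_of_nonneg fun k => sub_nonneg.2 (ha (by lia))]
      simp only [Finset.sum_range_sub' (fun k => a (k + N))]
      simpa using tendsto_const_nhds.sub ((tendsto_add_atTop_iff_nat N).2 h0)
    rw [Finset.sum_range_succ]
    convert! ih.add hstep using 1
    ext k
    rw [show k + (N + 1) = k + 1 + N by ring]
    ring

/-! ### The digamma function at quarter-integers -/

/-- The logarithmic derivative of the reflection formula `Γ(s) Γ(1-s) = π / sin (π s)` at
`s = 1/4`. -/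
theorem digamma_three_quarters_sub_one_quarter :
    Complex.digamma (3 / 4) - Complex.digamma (1 / 4) = Real.pi := by
  have hs : Complex.sin (Real.pi * (1 / 4)) = Complex.cos (Real.pi * (1 / 4)) := by
    rw [← Complex.sin_pi_div_two_sub]
    congr 1
    ring
  have hs0 : Complex.sin (Real.pi * (1 / 4)) ≠ 0 := by
    intro h
    have := Complex.sin_sq_add_cos_sq (Real.pi * (1 / 4))
    rw [← hs, h] at this
    simp at this
  have hne : ∀ x : ℝ, 0 < x → ∀ r : ℕ, (x : ℂ) ≠ -r := by
    intro x hx r h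
    have h1 := congrArg Complex.re h
    simp at h1
    have h2 : (0 : ℝ) ≤ r := r.cast_nonneg
    linarith
  have hne1 : ∀ r : ℕ, (1 / 4 : ℂ) ≠ -r := by simpa using hne (1 / 4) (by norm_num)
  have hne3 : ∀ r : ℕ, (3 / 4 : ℂ) ≠ -r := by simpa using hne (3 / 4) (by norm_num)
  have hG1 := (Complex.differentiableAt_Gamma _ hne1).hasDerivAt
  have hG3 := (Complex.differentiableAt_Gamma _ hne3).hasDerivAt
  have e : (1 : ℂ) - 1 / 4 = 3 / 4 := by norm_num
  have hprod : HasDerivAt (fun s : ℂ => Complex.Gamma s * Complex.Gamma (1 - s)) _ (1 / 4) :=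
    hG1.mul ((e ▸ hG3).comp (1 / 4 : ℂ) ((hasDerivAt_id (1 / 4 : ℂ)).const_sub 1))
  have hsin : HasDerivAt (fun s : ℂ => (Real.pi : ℂ) / Complex.sin (Real.pi * s)) _ (1 / 4) :=
    (hasDerivAt_const _ (Real.pi : ℂ)).div
      (((hasDerivAt_id (1 / 4 : ℂ)).const_mul (Real.pi : ℂ)).csin) hs0
  simp only [Complex.Gamma_mul_Gamma_one_sub] at hprod
  have key := hprod.unique hsin
  have hrefl := Complex.Gamma_mul_Gamma_one_sub (1 / 4)
  have h1 := Complex.Gamma_ne_zero hne1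
  have h3 := Complex.Gamma_ne_zero hne3
  simp only [id, e, ← hs] at key hrefl
  rw [Complex.digamma_def, logDeriv_apply, logDeriv_apply]
  field_simp at key hrefl ⊢
  linear_combination -key - Real.pi * hrefl

theorem digamma_half_shift_add (m : ℕ) :
    (Complex.digamma ((2 * (m : ℂ) + 5) / 4) - Complex.digamma ((2 * (m : ℂ) + 3) / 4)) +
      (Complex.digamma ((2 * (m : ℂ) + 7) / 4) - Complex.digamma ((2 * (m : ℂ) + 5) / 4)) =
      4 / (2 * (m : ℂ) + 3) := by
  have hne : ∀ r : ℕ, (2 * (m : ℂ) + 3) / 4 ≠ -r := by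
    intro r h
    have := congrArg Complex.re h
    simp at this
    have h1 : (0 : ℝ) ≤ m := m.cast_nonneg
    have h2 : (0 : ℝ) ≤ r := r.cast_nonneg
    linarith
  have h := Complex.digamma_apply_add_one _ hne
  rw [show (2 * (m : ℂ) + 3) / 4 + 1 = (2 * (m : ℂ) + 7) / 4 by ring, inv_div] at h
  rw [h]
  ring

theorem digamma_half_shift_eq (m : ℕ) :
    Complex.digamma ((2 * (m : ℂ) + 5) / 4) - Complex.digamma ((2 * (m : ℂ) + 3) / 4) =
      (-1) ^ m * (4 - Real.pi -
        4 * ∑ j ∈ Finset.Icc 1 m, (-1 : ℂ) ^ (j - 1) / (2 * (j : ℂ) + 1)) := by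
  induction m with
  | zero =>
    have hne : ∀ r : ℕ, (1 / 4 : ℂ) ≠ -r := by
      intro r h
      have := congrArg Complex.re h
      norm_num at this
      have h2 : (0 : ℝ) ≤ r := r.cast_nonneg
      linarith
    have h := Complex.digamma_apply_add_one _ hne
    rw [show (1 / 4 : ℂ) + 1 = 5 / 4 by norm_num] at h
    have h2 := digamma_three_quarters_sub_one_quarter
    simp
    rw [h]
    linear_combination -h2
  | succ m ih =>
    have h := digamma_half_shift_add m
    rw [ih] at h
    have h3 : 2 * (m : ℂ) + 3 ≠ 0 := by exact_mod_cast (by lia : 2 * m + 3 ≠ 0)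
    have h1 : ((-1 : ℂ) ^ m) ^ 2 = 1 := by rw [← pow_mul, mul_comm, pow_mul]; simp
    rw [Finset.sum_Icc_succ_top (by lia), Nat.add_sub_cancel, pow_succ]
    push_cast
    rw [show 2 * ((m : ℂ) + 1) + 5 = 2 * (m : ℂ) + 7 by ring,
      show 2 * ((m : ℂ) + 1) + 3 = 2 * (m : ℂ) + 5 by ring,
      show 2 * ((m : ℂ) + 1) + 1 = 2 * (m : ℂ) + 3 by ring]
    linear_combination h - 4 / (2 * (m : ℂ) + 3) * h1

/-! ### The double series and the case `n = 0` -/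

theorem ofReal_tsum_one_div_nat_cube :
    ((∑' n : ℕ, 1 / (n : ℝ) ^ 3 : ℝ) : ℂ) = riemannZeta 3 := by
  have := zeta_nat_eq_tsum_of_gt_one (k := 3) (by norm_num)
  push_cast at this ⊢
  rw [this]

/-- Passing to the sum over `k ≥ 1` drops the term at `k = 0`. -/
theorem hasSum_pnat_of_nat {f : ℕ → ℂ} {a : ℂ} (h : HasSum f a) :
    HasSum (fun k : ℕ+ => f k) (a - f 0) := by
  rw [hasSum_pnat_iff]
  simpa using h

theorem hasSum_alternating_euler_sum_complex :
    HasSum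
      (fun k : ℕ+ => (-1 : ℂ) ^ (k : ℕ) / (2 * ((k : ℕ) : ℂ) + 1) ^ 2 *
        ∑ j ∈ Finset.Icc 1 (k : ℕ), (-1 : ℂ) ^ (j - 1) / (2 * (j : ℂ) + 1))
      ((catalanConst : ℂ) - (Real.pi : ℂ) ^ 2 / 16 * (Real.log 2 : ℂ) -
        7 / 16 * riemannZeta 3) := by
  have h := hasSum_pnat_of_nat (Complex.hasSum_ofReal.2 hasSum_alternating_euler_sum_tail)
  convert! h using 1
  · ext k; push_cast; rfl
  · rw [← ofReal_tsum_one_div_nat_cube]; push_cast; simp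

theorem hasSum_neg_one_pow_div_odd_sq_pnat :
    HasSum (fun k : ℕ+ => (-1 : ℂ) ^ (k : ℕ) / (2 * ((k : ℕ) : ℂ) + 1) ^ 2)
      ((catalanConst : ℂ) - 1) := by
  have h := hasSum_pnat_of_nat (Complex.hasSum_ofReal.2 summable_neg_one_pow_div_odd_sq.hasSum)
  convert! h using 1
  · ext k; push_cast; rfl
  · simp [catalanConst]

theorem hasSum_thetaTerm_zero : HasSum (fun k : ℕ+ => thetaTerm 0 (k : ℕ))
    (-4 + (1 - (catalanConst : ℂ)) * (Real.pi : ℂ) +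
      (Real.pi : ℂ) ^ 2 / 4 * (Real.log 2 : ℂ) + 7 / 4 * riemannZeta 3) := by
  have h := (hasSum_neg_one_pow_div_odd_sq_pnat.mul_left (4 - (Real.pi : ℂ))).sub
    (hasSum_alternating_euler_sum_complex.mul_left 4)
  convert! h using 1
  · ext k
    rw [thetaTerm, Nat.cast_zero, mul_zero, add_zero, digamma_half_shift_eq]
    ring
  · ring

/-! ### The recurrence in `n` -/

open Filter Topology in
/-- The partial-fraction series coming from `ψ(x + 1) - ψ(x) = 1 / x`. -/
theorem hasSum_one_div_odd_sq_mul_odd_shift (n : ℕ) :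
    HasSum (fun k : ℕ => 4 / (2 * (k : ℝ) + 2 * n + 5) / (2 * (k : ℝ) + 3) ^ 2)
      ((Real.pi ^ 2 / 4 - 2) / (n + 1) -
        (∑ i ∈ Finset.range (n + 1), 1 / (2 * (i : ℝ) + 3)) / (n + 1) ^ 2) := by
  have hsq : HasSum (fun k : ℕ => 1 / (2 * (k : ℝ) + 3) ^ 2) (Real.pi ^ 2 / 8 - 1) := by
    have := (hasSum_nat_add_iff' 1).2 hasSum_one_div_odd_sq
    convert! this using 1
    · ext k; push_cast; ring
    · simp
  have htel : HasSum (fun k : ℕ => 1 / (2 * (k : ℝ) + 3) - 1 / (2 * (k : ℝ) + 2 * n + 5))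
      (∑ i ∈ Finset.range (n + 1), 1 / (2 * (i : ℝ) + 3)) := by
    have ha : Antitone fun k : ℕ => 1 / (2 * (k : ℝ) + 3) := fun x y h => by
      have : (x : ℝ) ≤ y := by exact_mod_cast h
      dsimp only
      gcongr
    have h0 : Tendsto (fun k : ℕ => 1 / (2 * (k : ℝ) + 3)) atTop (𝓝 0) := by
      simp only [one_div]
      refine tendsto_inv_atTop_zero.comp (tendsto_atTop_add_const_right _ _ ?_)
      exact tendsto_natCast_atTop_atTop.const_mul_atTop two_pos
    convert! hasSum_sub_shift_of_antitone ha h0 (n + 1) using 1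
    ext k
    push_cast
    rw [show 2 * ((k : ℝ) + (n + 1)) + 3 = 2 * (k : ℝ) + 2 * n + 5 by ring]
  have hn : (n : ℝ) + 1 ≠ 0 := by positivity
  convert! (hsq.mul_left (2 / ((n : ℝ) + 1))).sub (htel.mul_left (1 / ((n : ℝ) + 1) ^ 2)) using 1
  · ext k
    have h1 : 2 * (k : ℝ) + 2 * n + 5 ≠ 0 := by positivity
    have h2 : 2 * (k : ℝ) + 3 ≠ 0 := by positivity
    field_simp
    ring
  · field_simp
    ring

theorem hasSum_thetaTerm_succ {n : ℕ} {S : ℂ}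
    (h : HasSum (fun k : ℕ+ => thetaTerm n (k : ℕ)) S) :
    HasSum (fun k : ℕ+ => thetaTerm (n + 1) (k : ℕ))
      (((Real.pi : ℂ) ^ 2 / 4 - 2) / (n + 1) -
        (∑ i ∈ Finset.range (n + 1), 1 / (2 * (i : ℂ) + 3)) / (n + 1) ^ 2 - S) := by
  rw [hasSum_pnat_iff_hasSum_succ (f := fun k => thetaTerm n k)] at h
  rw [hasSum_pnat_iff_hasSum_succ (f := fun k => thetaTerm (n + 1) k)]
  convert! (Complex.hasSum_ofReal.2 (hasSum_one_div_odd_sq_mul_odd_shift n)).sub h using 1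
  · ext k
    have e := digamma_half_shift_add (k + 1 + n)
    simp only [thetaTerm]
    push_cast at e ⊢
    rw [show 2 * ((k : ℂ) + 1) + 2 * ((n : ℂ) + 1) + 5 = 2 * ((k : ℂ) + 1 + n) + 7 by ring,
      show 2 * ((k : ℂ) + 1) + 2 * ((n : ℂ) + 1) + 3 = 2 * ((k : ℂ) + 1 + n) + 5 by ring,
      show 2 * ((k : ℂ) + 1) + 2 * (n : ℂ) + 5 = 2 * ((k : ℂ) + 1 + n) + 5 by ring,
      show 2 * ((k : ℂ) + 1) + 2 * (n : ℂ) + 3 = 2 * ((k : ℂ) + 1 + n) + 3 by ring,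
      show 2 * ((k : ℂ) + 1) + 1 = 2 * (k : ℂ) + 3 by ring,
      show 2 * (k : ℂ) + 2 * (n : ℂ) + 5 = 2 * ((k : ℂ) + 1 + n) + 3 by ring,
      ← e]
    ring
  · push_cast; rfl

theorem sum_one_div_odd_eq_harmonic (m : ℕ) :
    ∑ i ∈ Finset.range m, 1 / (2 * (i : ℂ) + 3) =
      (harmonic (2 * m + 1) : ℂ) - (harmonic m : ℂ) / 2 - 1 := by
  induction m with
  | zero => simp
  | succ m ih =>
    have h1 : 2 * (m : ℂ) + 3 ≠ 0 := by exact_mod_cast (by lia : 2 * m + 3 ≠ 0)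
    have h2 : (m : ℂ) + 1 ≠ 0 := by exact_mod_cast (by lia : m + 1 ≠ 0)
    have h3 : 2 * (m : ℂ) + 2 ≠ 0 := by exact_mod_cast (by lia : 2 * m + 2 ≠ 0)
    rw [Finset.sum_range_succ, ih, show 2 * (m + 1) + 1 = 2 * m + 1 + 1 + 1 by ring,
      harmonic_succ (2 * m + 1 + 1), harmonic_succ (2 * m + 1), harmonic_succ m]
    push_cast
    rw [show 2 * (m : ℂ) + 1 + 1 + 1 = 2 * m + 3 by ring,
      show 2 * (m : ℂ) + 1 + 1 = 2 * (m + 1) by ring]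
    field_simp
    ring

/-! ### Closed forms for `n ≥ 1` -/

theorem hasSum_thetaTerm_one : HasSum (fun k : ℕ+ => thetaTerm 1 (k : ℕ))
    (5 / 3 - (1 - (catalanConst : ℂ)) * (Real.pi : ℂ) +
      (1 - (Real.log 2 : ℂ)) * ((Real.pi : ℂ) ^ 2 / 4) - 7 / 4 * riemannZeta 3) := by
  convert! hasSum_thetaTerm_succ hasSum_thetaTerm_zero using 1
  simp
  ring

theorem hasSum_thetaTerm_two : HasSum (fun k : ℕ+ => thetaTerm 2 (k : ℕ))
    (-(14 / 5) + (1 - (catalanConst : ℂ)) * (Real.pi : ℂ) +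
      ((Real.log 2 : ℂ) - 1 / 2) * ((Real.pi : ℂ) ^ 2 / 4) + 7 / 4 * riemannZeta 3) := by
  convert! hasSum_thetaTerm_succ hasSum_thetaTerm_one using 1
  simp [Finset.sum_range_succ]
  ring

/-- The formula for odd `n`; with empty sums it also covers `n = 1`, where the induction starts. -/
theorem hasSum_thetaTerm_odd (m : ℕ) :
    HasSum (fun k : ℕ+ => thetaTerm (2 * m + 1) (k : ℕ))
      (3
        - 1 / 8 * ∑ j ∈ Finset.Icc 1 m,
            (4 * (j : ℂ) + 1) *
              ((harmonic (2 * j - 1) : ℂ) - 2 * (harmonic (4 * j - 1) : ℂ)) /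
              ((j : ℂ) ^ 2 * (2 * (j : ℂ) + 1) ^ 2)
        - ∑ j ∈ Finset.Icc 1 m, 1 / ((2 * (j : ℂ) + 1) ^ 2 * (4 * (j : ℂ) + 1))
        + 4 * ∑ j ∈ Finset.Icc 1 (2 * m + 1), (-1 : ℂ) ^ j / (2 * (j : ℂ) + 1)
        - (1 - (catalanConst : ℂ)) * (Real.pi : ℂ)
        + (1 - (Real.log 2 : ℂ) -
            1 / 2 * ∑ j ∈ Finset.Icc 1 m, 1 / ((j : ℂ) * (2 * (j : ℂ) + 1))) *
            ((Real.pi : ℂ) ^ 2 / 4)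
        - 7 / 4 * riemannZeta 3) := by
  induction m with
  | zero =>
    convert! hasSum_thetaTerm_one using 1
    simp
    ring
  | succ m ih =>
    have h := hasSum_thetaTerm_succ (hasSum_thetaTerm_succ ih)
    convert! h using 1
    have hpow : (-1 : ℂ) ^ (2 * m + 1) = -1 := by rw [pow_succ, pow_mul]; simp
    rw [show 2 * (m + 1) + 1 = 2 * m + 1 + 1 + 1 by ring]
    simp only [Finset.sum_Icc_succ_top (show 1 ≤ 2 * m + 1 + 1 + 1 by lia),
      Finset.sum_Icc_succ_top (show 1 ≤ 2 * m + 1 + 1 by lia),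
      Finset.sum_Icc_succ_top (show 1 ≤ m + 1 by lia), Finset.sum_range_succ _ (2 * m + 1 + 1),
      pow_succ _ (2 * m + 1 + 1), pow_succ _ (2 * m + 1), hpow]
    rw [sum_one_div_odd_eq_harmonic, show 2 * (2 * m + 1 + 1) + 1 = 4 * m + 3 + 1 + 1 by ring,
      show 4 * (m + 1) - 1 = 4 * m + 3 by lia, show 2 * (m + 1) - 1 = 2 * m + 1 by lia,
      harmonic_succ (4 * m + 3 + 1), harmonic_succ (4 * m + 3), harmonic_succ (2 * m + 1)]
    have h1 : (m : ℂ) + 1 ≠ 0 := by exact_mod_cast (by lia : m + 1 ≠ 0)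
    have h3 : (m : ℂ) * 2 + 3 ≠ 0 := by exact_mod_cast (by lia : m * 2 + 3 ≠ 0)
    have h5 : 4 * (m : ℂ) + 5 ≠ 0 := by exact_mod_cast (by lia : 4 * m + 5 ≠ 0)
    have h7 : 4 * (m : ℂ) + 7 ≠ 0 := by exact_mod_cast (by lia : 4 * m + 7 ≠ 0)
    push_cast
    -- The sums up to `m` occur on both sides and play no role in the rational identity.
    generalize ∑ j ∈ Finset.Icc 1 m, (4 * (j : ℂ) + 1) *
      ((harmonic (2 * j - 1) : ℂ) - 2 * (harmonic (4 * j - 1) : ℂ)) /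
      ((j : ℂ) ^ 2 * (2 * (j : ℂ) + 1) ^ 2) = A
    generalize ∑ j ∈ Finset.Icc 1 m, 1 / ((2 * (j : ℂ) + 1) ^ 2 * (4 * (j : ℂ) + 1)) = B
    generalize ∑ j ∈ Finset.Icc 1 m, 1 / ((j : ℂ) * (2 * (j : ℂ) + 1)) = C
    generalize ∑ j ∈ Finset.Icc 1 (2 * m + 1), (-1 : ℂ) ^ j / (2 * (j : ℂ) + 1) = D
    rw [show 2 * ((m : ℂ) + 1) + 1 = 2 * m + 3 by ring,
      show 4 * ((m : ℂ) + 1) + 1 = 4 * m + 5 by ring,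
      show 2 * (m : ℂ) + 1 + 1 = 2 * (m + 1) by ring,
      show 4 * (m : ℂ) + 3 + 1 = 4 * (m + 1) by ring,
      show 4 * ((m : ℂ) + 1) + 1 = 4 * m + 5 by ring,
      show 2 * ((m : ℂ) + 1) + 1 = 2 * m + 3 by ring,
      show 2 * (2 * ((m : ℂ) + 1)) + 1 = 4 * m + 5 by ring,
      show 2 * (2 * ((m : ℂ) + 1)) + 3 = 4 * m + 7 by ring,
      show 2 * (2 * (m : ℂ) + 2 + 1) + 1 = 4 * m + 7 by ring]
    field_simp
    ring

/-- The formula for even `n ≥ 2`; with empty sums it also covers `n = 2`, where the induction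
starts. -/
theorem hasSum_thetaTerm_even (m : ℕ) :
    HasSum (fun k : ℕ+ => thetaTerm (2 * m + 2) (k : ℕ))
      (-(10 / 3)
        - 1 / 8 * ∑ j ∈ Finset.Icc 1 m,
            (3 + 4 * (j : ℂ)) *
              ((harmonic (2 * j - 1) : ℂ) - 2 * (harmonic (4 * j - 1) : ℂ)) /
              (((j : ℂ) + 1) ^ 2 * (2 * (j : ℂ) + 1) ^ 2)
        - ∑ j ∈ Finset.Icc 1 m,
            (4 * (j : ℂ) ^ 3 + (j : ℂ) ^ 2 - 4 * (j : ℂ) - 2) /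
              (((j : ℂ) + 1) ^ 2 * (2 * (j : ℂ) + 1) ^ 2 *
                (4 * (j : ℂ) + 3) * (4 * (j : ℂ) + 1))
        - 4 * ∑ j ∈ Finset.Icc 1 (2 * m + 2), (-1 : ℂ) ^ j / (2 * (j : ℂ) + 1)
        + (1 - (catalanConst : ℂ)) * (Real.pi : ℂ)
        + ((Real.log 2 : ℂ) - 1 / 2 -
            1 / 2 * ∑ j ∈ Finset.Icc 1 m, 1 / (((j : ℂ) + 1) * (2 * (j : ℂ) + 1))) *
            ((Real.pi : ℂ) ^ 2 / 4)
        + 7 / 4 * riemannZeta 3) := by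
  induction m with
  | zero =>
    convert! hasSum_thetaTerm_two using 1
    simp [Finset.sum_Icc_succ_top]
    ring
  | succ m ih =>
    have h := hasSum_thetaTerm_succ (hasSum_thetaTerm_succ ih)
    convert! h using 1
    have hpow : (-1 : ℂ) ^ (2 * m + 2) = 1 := by
      rw [show 2 * m + 2 = 2 * (m + 1) by ring, pow_mul]; simp
    rw [show 2 * (m + 1) + 2 = 2 * m + 2 + 1 + 1 by ring]
    simp only [Finset.sum_Icc_succ_top (show 1 ≤ 2 * m + 2 + 1 + 1 by lia),
      Finset.sum_Icc_succ_top (show 1 ≤ 2 * m + 2 + 1 by lia),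
      Finset.sum_Icc_succ_top (show 1 ≤ m + 1 by lia), Finset.sum_range_succ _ (2 * m + 2 + 1),
      Finset.sum_range_succ _ (2 * m + 2),
      pow_succ _ (2 * m + 2 + 1), pow_succ _ (2 * m + 2), hpow]
    rw [sum_one_div_odd_eq_harmonic, show 2 * (2 * m + 2) + 1 = 4 * m + 3 + 1 + 1 by ring,
      show 4 * (m + 1) - 1 = 4 * m + 3 by lia, show 2 * (m + 1) - 1 = 2 * m + 1 by lia,
      harmonic_succ (4 * m + 3 + 1), harmonic_succ (4 * m + 3), harmonic_succ (2 * m + 1)]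
    have h1 : (m : ℂ) + 1 ≠ 0 := by exact_mod_cast (by lia : m + 1 ≠ 0)
    have h2 : (m : ℂ) + 2 ≠ 0 := by exact_mod_cast (by lia : m + 2 ≠ 0)
    have h3 : (m : ℂ) * 2 + 3 ≠ 0 := by exact_mod_cast (by lia : m * 2 + 3 ≠ 0)
    have h5 : 4 * (m : ℂ) + 5 ≠ 0 := by exact_mod_cast (by lia : 4 * m + 5 ≠ 0)
    have h7 : 4 * (m : ℂ) + 7 ≠ 0 := by exact_mod_cast (by lia : 4 * m + 7 ≠ 0)
    have h9 : 4 * (m : ℂ) + 9 ≠ 0 := by exact_mod_cast (by lia : 4 * m + 9 ≠ 0)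
    push_cast
    -- The sums up to `m` occur on both sides and play no role in the rational identity.
    generalize ∑ j ∈ Finset.Icc 1 m, (3 + 4 * (j : ℂ)) *
      ((harmonic (2 * j - 1) : ℂ) - 2 * (harmonic (4 * j - 1) : ℂ)) /
      (((j : ℂ) + 1) ^ 2 * (2 * (j : ℂ) + 1) ^ 2) = A
    generalize ∑ j ∈ Finset.Icc 1 m, (4 * (j : ℂ) ^ 3 + (j : ℂ) ^ 2 - 4 * (j : ℂ) - 2) /
      (((j : ℂ) + 1) ^ 2 * (2 * (j : ℂ) + 1) ^ 2 * (4 * (j : ℂ) + 3) * (4 * (j : ℂ) + 1)) = B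
    generalize ∑ j ∈ Finset.Icc 1 m, 1 / (((j : ℂ) + 1) * (2 * (j : ℂ) + 1)) = C
    generalize ∑ j ∈ Finset.Icc 1 (2 * m + 2), (-1 : ℂ) ^ j / (2 * (j : ℂ) + 1) = D
    rw [show 3 + 4 * ((m : ℂ) + 1) = 4 * m + 7 by ring,
      show (m : ℂ) + 1 + 1 = m + 2 by ring,
      show 2 * ((m : ℂ) + 1) + 1 = 2 * m + 3 by ring,
      show 4 * ((m : ℂ) + 1) + 3 = 4 * m + 7 by ring,
      show 4 * ((m : ℂ) + 1) + 1 = 4 * m + 5 by ring,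
      show 2 * (2 * (m : ℂ) + 2 + 1) + 1 = 4 * m + 7 by ring,
      show 2 * (2 * (m : ℂ) + 3 + 1) + 1 = 4 * m + 9 by ring,
      show 2 * (2 * (m : ℂ) + 2 + 1) + 3 = 4 * m + 9 by ring,
      show 2 * (2 * (m : ℂ) + 2) + 3 = 4 * m + 7 by ring,
      show 2 * (m : ℂ) + 2 + 1 + 1 = 2 * (m + 2) by ring,
      show 2 * (m : ℂ) + 2 + 1 = 2 * m + 3 by ring,
      show 2 * (m : ℂ) + 1 + 1 = 2 * (m + 1) by ring,
      show 4 * (m : ℂ) + 3 + 1 + 1 = 4 * m + 5 by ring,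
      show 4 * (m : ℂ) + 3 + 1 = 4 * (m + 1) by ring]
    field_simp
    ring

/-! ### The evaluations -/

theorem theorem1 :
    -- the key double series
    HasSum
      (fun k : ℕ+ => (-1 : ℂ) ^ (k : ℕ) / (2 * ((k : ℕ) : ℂ) + 1) ^ 2 *
        ∑ j ∈ Finset.Icc 1 (k : ℕ), (-1 : ℂ) ^ (j - 1) / (2 * (j : ℂ) + 1))
      ((catalanConst : ℂ) - (Real.pi : ℂ) ^ 2 / 16 * (Real.log 2 : ℂ) -
        7 / 16 * riemannZeta 3) ∧
    -- the case n = 0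
    HasSum (fun k : ℕ+ => thetaTerm 0 (k : ℕ))
      (-4 + (1 - (catalanConst : ℂ)) * (Real.pi : ℂ) +
        (Real.pi : ℂ) ^ 2 / 4 * (Real.log 2 : ℂ) + 7 / 4 * riemannZeta 3) ∧
    -- the case n = 1
    HasSum (fun k : ℕ+ => thetaTerm 1 (k : ℕ))
      (5 / 3 - (1 - (catalanConst : ℂ)) * (Real.pi : ℂ) +
        (1 - (Real.log 2 : ℂ)) * ((Real.pi : ℂ) ^ 2 / 4) - 7 / 4 * riemannZeta 3) ∧
    -- the case n = 2
    HasSum (fun k : ℕ+ => thetaTerm 2 (k : ℕ))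
      (-(14 / 5) + (1 - (catalanConst : ℂ)) * (Real.pi : ℂ) +
        ((Real.log 2 : ℂ) - 1 / 2) * ((Real.pi : ℂ) ^ 2 / 4) + 7 / 4 * riemannZeta 3) ∧
    -- n odd, n ≠ 1
    (∀ n : ℕ, Odd n → n ≠ 1 →
      HasSum (fun k : ℕ+ => thetaTerm n (k : ℕ))
        (3
          - 1 / 8 * ∑ j ∈ Finset.Icc 1 ((n - 1) / 2),
              (4 * (j : ℂ) + 1) *
                ((harmonic (2 * j - 1) : ℂ) - 2 * (harmonic (4 * j - 1) : ℂ)) /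
                ((j : ℂ) ^ 2 * (2 * (j : ℂ) + 1) ^ 2)
          - ∑ j ∈ Finset.Icc 1 ((n - 1) / 2),
              1 / ((2 * (j : ℂ) + 1) ^ 2 * (4 * (j : ℂ) + 1))
          + 4 * ∑ j ∈ Finset.Icc 1 n, (-1 : ℂ) ^ j / (2 * (j : ℂ) + 1)
          - (1 - (catalanConst : ℂ)) * (Real.pi : ℂ)
          + (1 - (Real.log 2 : ℂ) -
              1 / 2 * ∑ j ∈ Finset.Icc 1 ((n - 1) / 2), 1 / ((j : ℂ) * (2 * (j : ℂ) + 1))) *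
              ((Real.pi : ℂ) ^ 2 / 4)
          - 7 / 4 * riemannZeta 3)) ∧
    -- n even, n ≠ 0, n ≠ 2
    (∀ n : ℕ, Even n → n ≠ 0 → n ≠ 2 →
      HasSum (fun k : ℕ+ => thetaTerm n (k : ℕ))
        (-(10 / 3)
          - 1 / 8 * ∑ j ∈ Finset.Icc 1 ((n - 2) / 2),
              (3 + 4 * (j : ℂ)) *
                ((harmonic (2 * j - 1) : ℂ) - 2 * (harmonic (4 * j - 1) : ℂ)) /
                (((j : ℂ) + 1) ^ 2 * (2 * (j : ℂ) + 1) ^ 2)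
          - ∑ j ∈ Finset.Icc 1 ((n - 2) / 2),
              (4 * (j : ℂ) ^ 3 + (j : ℂ) ^ 2 - 4 * (j : ℂ) - 2) /
                (((j : ℂ) + 1) ^ 2 * (2 * (j : ℂ) + 1) ^ 2 *
                  (4 * (j : ℂ) + 3) * (4 * (j : ℂ) + 1))
          - 4 * ∑ j ∈ Finset.Icc 1 n, (-1 : ℂ) ^ j / (2 * (j : ℂ) + 1)
          + (1 - (catalanConst : ℂ)) * (Real.pi : ℂ)
          + ((Real.log 2 : ℂ) - 1 / 2 -
              1 / 2 * ∑ j ∈ Finset.Icc 1 ((n - 2) / 2),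
                1 / (((j : ℂ) + 1) * (2 * (j : ℂ) + 1))) *
              ((Real.pi : ℂ) ^ 2 / 4)
          + 7 / 4 * riemannZeta 3)) := by
  refine ⟨hasSum_alternating_euler_sum_complex, hasSum_thetaTerm_zero, hasSum_thetaTerm_one,
    hasSum_thetaTerm_two, ?_, ?_⟩
  · rintro n ⟨m, rfl⟩ -
    rw [show (2 * m + 1 - 1) / 2 = m by lia]
    exact hasSum_thetaTerm_odd m
  · intro n hn h0 _
    obtain ⟨m, rfl⟩ : ∃ m, n = 2 * m + 2 := by
      obtain ⟨r, rfl⟩ := hn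
      exact ⟨r - 1, by lia⟩
    rw [show (2 * m + 2 - 2) / 2 = m by lia]
    exact hasSum_thetaTerm_even m
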